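/- Let $\mathbf A\in\mathbb R^{n\times p}$, $\boldsymbol y\in\mathbb R^n$, let $\|\cdot\|$ be the Euclidean norm, and let $$F(\boldsymbol x)=\|\boldsymbol x\|_1+\tfrac12\|\mathbf A\boldsymbol x-\boldsymbol y\|^2,\qquad \boldsymbol x\in\mathbb R^p .$$ Fix $\kappa>0$. For $\beta>0$ let $X_\beta$ be a random vector of $\mathbb R^p$ with probability density proportional to $\exp(-\kappa\beta F(\boldsymbol x))$. Let $\boldsymbol x(\boldsymbol y)$ be a minimizer of $F$ (a Lasso estimator) and put $$\xi=\mathbf A^*(\boldsymbol y-\mathbf A\boldsymbol x(\boldsymbol y)),\quad \partial I=\{i:|\xi_i|=1\},\quad S=\{i:x_i(\boldsymbol y)\ne0\},\quad I_0=\{i:x_i(\boldsymbol y)=0\},\quad \partial I_0=\{i\in I_0:|\xi_i|=1\}.$$ For $J\subset\{1,\dots,p\}$ let $\mathbf A_J$ be the submatrix of the columns of $\mathbf A$ indexed by $J$. Assume that $\mathbf A_{\partial I}^*\mathbf A_{\partial I}$ is invertible. Then, as $\beta\to+\infty$, the two blocks $$U_\beta=\big(\beta X_\beta(i):\ i\in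 I_0\setminus\partial I_0\big),\qquad V_\beta=\big(\sqrt\beta\,(X_\beta(i)-x_i(\boldsymbol y)):\ i\in S\cup\partial I_0\big)$$ are asymptotically independent: the total variation distance between the law of $(U_\beta,V_\beta)$ and the product of the laws of $U_\beta$ and $V_\beta$ tends to $0$. Moreover the laws of $U_\beta$ and $V_\beta$ converge in total variation to the probability measures whose densities are proportional, respectively, to $$u\mapsto\prod_{i\in I_0\setminus\partial I_0}\exp\big(-\kappa|u_i|(1-\operatorname{sgn}(u_i)\xi_i)\big),$$ $$v\mapsto\exp\Big(-\frac{\kappa}{2}\|\mathbf A_{S\cup\partial I_0}v\|^2\Big)\,\mathbf 1\{\xi_iv_i\ge0\ \text{for all } i\in\partial I_0\},$$ and these two functions have positive finite integrals. (If $\partial I_0=\emptyset$ the second limit is an ordinary centred Gaussian.) -/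

import Mathlib

open MeasureTheory ProbabilityTheory Filter Topology Matrix

noncomputable section

namespace BayesLasso

variable {n p : ℕ}

/-- The Euclidean norm on coordinate vectors. -/
def euclNorm {ι : Type*} [Fintype ι] (v : ι → ℝ) : ℝ := ‖WithLp.toLp 2 v‖

/-- The Lasso objective `F(x) = ‖x‖₁ + ‖A x - y‖² / 2` (with the Euclidean norm). -/
def objective (A : Matrix (Fin n) (Fin p) ℝ) (y : Fin n → ℝ) (x : Fin p → ℝ) : ℝ :=
  (∑ i, |x i|) + euclNorm (A *ᵥ x - y) ^ 2 / 2

/-- `x` is a Lasso estimator: a global minimizer of the objective. -/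
def IsLasso (A : Matrix (Fin n) (Fin p) ℝ) (y : Fin n → ℝ) (x : Fin p → ℝ) : Prop :=
  ∀ z : Fin p → ℝ, objective A y x ≤ objective A y z

/-- The probability measure on `ℝ^ι` whose Lebesgue density is proportional to `h ≥ 0`
(meaningful when the integral of `h` is positive and finite; it is the zero measure otherwise). -/
def measureOfPropDensity {ι : Type*} [Fintype ι] (h : (ι → ℝ) → ℝ) : Measure (ι → ℝ) :=
  (∫⁻ x, ENNReal.ofReal (h x))⁻¹ • volume.withDensity (fun x => ENNReal.ofReal (h x))

/-- The law on `ℝ^p` with density `exp(-κ β F(x)) / Z`. -/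
def posterior (A : Matrix (Fin n) (Fin p) ℝ) (y : Fin n → ℝ) (κ β : ℝ) : Measure (Fin p → ℝ) :=
  measureOfPropDensity fun x => Real.exp (-(κ * β * objective A y x))

/-- `ξ = Aᵀ (y - A x)`. -/
def dual (A : Matrix (Fin n) (Fin p) ℝ) (y : Fin n → ℝ) (x : Fin p → ℝ) : Fin p → ℝ :=
  Aᵀ *ᵥ (y - A *ᵥ x)

open Classical in
/-- `∂I = {i : |ξ_i| = 1}`. -/
def bdryI (A : Matrix (Fin n) (Fin p) ℝ) (y : Fin n → ℝ) (x : Fin p → ℝ) : Finset (Fin p) :=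
  Finset.univ.filter fun i => |dual A y x i| = 1

open Classical in
/-- The support `S = {i : x_i ≠ 0}`. -/
def supp (x : Fin p → ℝ) : Finset (Fin p) := Finset.univ.filter fun i => x i ≠ 0

open Classical in
/-- `I₀ = {i : x_i = 0}`. -/
def I0 (x : Fin p → ℝ) : Finset (Fin p) := Finset.univ.filter fun i => x i = 0

open Classical in
/-- `∂I₀ = {i : x_i = 0 and |ξ_i| = 1}`. -/
def bdryI0 (A : Matrix (Fin n) (Fin p) ℝ) (y : Fin n → ℝ) (x : Fin p → ℝ) : Finset (Fin p) :=
  Finset.univ.filter fun i => x i = 0 ∧ |dual A y x i| = 1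

/-- The submatrix `A_J` made of the columns of `A` indexed by `J`. -/
def cols (A : Matrix (Fin n) (Fin p) ℝ) (J : Finset (Fin p)) : Matrix (Fin n) J ℝ :=
  A.submatrix id (fun j : J => (j : Fin p))

/-- The unnormalized limit density of the block `(β X_β(i))`, `i ∈ I₀ ∖ ∂I₀`:
`∏ exp(-κ |u_i| (1 - sgn(u_i) ξ_i))`. -/
def laplaceDensity (A : Matrix (Fin n) (Fin p) ℝ) (y : Fin n → ℝ) (xs : Fin p → ℝ) (κ : ℝ)
    (u : ↥(I0 xs \ bdryI0 A y xs) → ℝ) : ℝ :=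
  ∏ i, Real.exp (-(κ * (|u i| * (1 - Real.sign (u i) * dual A y xs i))))

/-- The unnormalized limit density of the block `(√β (X_β(i) - x_i(y)))`, `i ∈ S ∪ ∂I₀`:
`exp(-κ ‖A_{S ∪ ∂I₀} v‖² / 2)` on the set of `v` with `ξ_i v_i ≥ 0` for all `i ∈ ∂I₀`,
and `0` elsewhere. -/
def gaussDensity (A : Matrix (Fin n) (Fin p) ℝ) (y : Fin n → ℝ) (xs : Fin p → ℝ) (κ : ℝ) :
    (↥(supp xs ∪ bdryI0 A y xs) → ℝ) → ℝ :=
  Set.indicator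
    {v | ∀ i : ↥(supp xs ∪ bdryI0 A y xs), (i : Fin p) ∈ bdryI0 A y xs →
      0 ≤ dual A y xs i * v i}
    (fun v => Real.exp (-(κ * (euclNorm (cols A (supp xs ∪ bdryI0 A y xs) *ᵥ v) ^ 2 / 2))))

/-- The total variation distance between the (finite) measures `μ b` and `ν b` tends to `0`
as `b → +∞`: the supremum over measurable sets `B` of `|μ b B - ν b B|` tends to `0`. -/
def TVClose {E : Type*} [MeasurableSpace E] (μ ν : ℝ → Measure E) : Prop :=
  ∀ ε : ℝ, 0 < ε → ∀ᶠ b in atTop, ∀ B : Set E, MeasurableSet B →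
    |(μ b).real B - (ν b).real B| ≤ ε

/-- Asymptotic independence of `U b` and `V b` as `b → +∞`: the joint law and the product of the
two marginal laws become close in total variation. -/
def AsympIndep {Ω : ℝ → Type*} [∀ b, MeasurableSpace (Ω b)] (P : ∀ b, Measure (Ω b))
    {E E' : Type*} [MeasurableSpace E] [MeasurableSpace E']
    (U : ∀ b, Ω b → E) (V : ∀ b, Ω b → E') : Prop :=
  TVClose (fun b => (P b).map fun ω => (U b ω, V b ω))
    (fun b => ((P b).map (U b)).prod ((P b).map (V b)))

/-- The law of `U b` converges in total variation, as `b → +∞`, to the probability measure whose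
density is proportional to `h`. -/
def HasAsympDensity {Ω : ℝ → Type*} [∀ b, MeasurableSpace (Ω b)] (P : ∀ b, Measure (Ω b))
    {ι : Type*} [Fintype ι] (U : ∀ b, Ω b → ι → ℝ) (h : (ι → ℝ) → ℝ) : Prop :=
  IsProbabilityMeasure (measureOfPropDensity h) ∧
    TVClose (fun b => (P b).map (U b)) (fun _ => measureOfPropDensity h)

end BayesLasso

end

/-! Write `x = xs + h` with `h = u / β` on `K = I₀ ∖ ∂I₀` and `h = v / √β` on `J = S ∪ ∂I₀`. Since
`F` is an ℓ¹ norm plus a quadratic, `objective_add` expands it exactly: the linear part of the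
quadratic is `-ξ·h`, which joins `|x + h| - |x|` to form the subgradient gaps. After multiplication
by `β` (`rescaledGap_eq`) the gaps on `K` are independent of `β`. On `S` they vanish for large `β`,
because `|·|` is affine near `x_i ≠ 0`. On `∂I₀` they equal `√β (|v_i| - ξ_i v_i)`, which is `0` or
tends to infinity and so produces the sign constraint. The cross term between `A_K u` and `A_J v`
carries a factor `1/√β` and disappears; hence the limit density is a product
(`tendsto_exp_rescaledGap`).

Domination comes from `exists_le_rescaledGap`: on `K` one has `|ξ_i| < 1`, and on `J` the Gram
matrix is invertible because `∂I = S ∪ ∂I₀` (`IsLasso.bdryI_eq`), so the rescaled gap grows at least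
like an ℓ¹ norm, uniformly in `β ≥ 1`. Scheffé's lemma (`tvClose_normalizedDensity`) then gives
total variation convergence of the joint law to a product, and `asympIndep_of_tvClose_prod` deduces
both the marginal limits and asymptotic independence. -/

noncomputable section

namespace BayesLasso

/-! ### Normalized densities and Scheffé's lemma. -/

section NormalizedDensity

variable {α γ : Type*} [MeasurableSpace α] [MeasurableSpace γ]

/-- The probability measure whose density with respect to `μ` is proportional to `f`. -/
def normalizedDensity (μ : Measure α) (f : α → ℝ) : Measure α :=
  (∫⁻ x, ENNReal.ofReal (f x) ∂μ)⁻¹ • μ.withDensity (fun x => ENNReal.ofReal (f x))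

theorem measureOfPropDensity_eq {ι : Type*} [Fintype ι] (h : (ι → ℝ) → ℝ) :
    measureOfPropDensity h = normalizedDensity volume h := rfl

theorem normalizedDensity_real {μ : Measure α} {f : α → ℝ} (hf : 0 ≤ f) (hi : Integrable f μ)
    {B : Set α} (hB : MeasurableSet B) :
    (normalizedDensity μ f).real B = (∫ x in B, f x ∂μ) / ∫ x, f x ∂μ := by
  rw [normalizedDensity, measureReal_ennreal_smul_apply, measureReal_def,
    withDensity_apply _ hB,
    integral_eq_lintegral_of_nonneg_ae (Eventually.of_forall hf) hi.aestronglyMeasurable,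
    integral_eq_lintegral_of_nonneg_ae (Eventually.of_forall hf)
      hi.aestronglyMeasurable.restrict, ENNReal.toReal_inv]
  ring

theorem isProbabilityMeasure_normalizedDensity {μ : Measure α} {f : α → ℝ} (hf : 0 ≤ f)
    (hi : Integrable f μ) (hpos : 0 < ∫ x, f x ∂μ) :
    IsProbabilityMeasure (normalizedDensity μ f) := by
  constructor
  rw [normalizedDensity, Measure.smul_apply, withDensity_apply _ MeasurableSet.univ,
    Measure.restrict_univ, smul_eq_mul, ← ofReal_integral_eq_lintegral_ofReal hi
      (Eventually.of_forall hf)]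
  exact ENNReal.inv_mul_cancel (by simpa using hpos) ENNReal.ofReal_ne_top

theorem normalizedDensity_const_mul {μ : Measure α} {f : α → ℝ} {a : ℝ} (ha : 0 < a) :
    normalizedDensity μ (fun x => a * f x) = normalizedDensity μ f := by
  have h0 : ENNReal.ofReal a ≠ 0 := by simpa using ha
  have h : (fun x => ENNReal.ofReal (a * f x)) =
      ENNReal.ofReal a • fun x => ENNReal.ofReal (f x) := by
    ext x; simp [ENNReal.ofReal_mul ha.le]
  have hl : ∫⁻ x, ENNReal.ofReal (a * f x) ∂μ = ENNReal.ofReal a * ∫⁻ x, ENNReal.ofReal (f x) ∂μ := by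
    rw [h, ← lintegral_const_mul' _ _ ENNReal.ofReal_ne_top]; rfl
  rw [normalizedDensity, normalizedDensity, hl, h, withDensity_smul' _ _ ENNReal.ofReal_ne_top,
    smul_smul, ENNReal.mul_inv (Or.inl h0) (Or.inl ENNReal.ofReal_ne_top), mul_right_comm,
    ENNReal.inv_mul_cancel h0 ENNReal.ofReal_ne_top, one_mul]

/-- Normalization cancels constants, so the Jacobian of the rescaling never has to be computed. -/
theorem normalizedDensity_smul_measure {μ : Measure α} {f : α → ℝ} {c : ENNReal} (h0 : c ≠ 0)
    (ht : c ≠ ⊤) : normalizedDensity (c • μ) f = normalizedDensity μ f := by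
  simp only [normalizedDensity]
  rw [withDensity_smul_measure, smul_smul, lintegral_smul_measure, smul_eq_mul,
    ENNReal.mul_inv (Or.inl h0) (Or.inl ht), mul_right_comm,
    ENNReal.inv_mul_cancel h0 ht, one_mul]

theorem map_normalizedDensity {μ : Measure α} (e : α ≃ᵐ γ) (f : γ → ℝ) :
    (normalizedDensity μ (f ∘ e)).map e = normalizedDensity (μ.map e) f := by
  have hl : ∫⁻ x, ENNReal.ofReal (f x) ∂(μ.map e) = ∫⁻ x, ENNReal.ofReal (f (e x)) ∂μ :=
    lintegral_map_equiv _ e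
  simp only [normalizedDensity]
  rw [hl, Measure.map_smul]
  congr 1
  ext B hB
  rw [Measure.map_apply e.measurable hB, withDensity_apply _ (e.measurable hB),
    withDensity_apply _ hB, e.restrict_map, lintegral_map_equiv]
  rfl

theorem normalizedDensity_prod {μ : Measure α} {ν : Measure γ} [SFinite μ] [SFinite ν]
    {f : α → ℝ} {g : γ → ℝ} (hf : Measurable f) (hg : Measurable g) (hf0 : 0 ≤ f)
    (hfi : Integrable f μ) (hfpos : 0 < ∫ x, f x ∂μ) :
    (normalizedDensity μ f).prod (normalizedDensity ν g) =
      normalizedDensity (μ.prod ν) (fun z => f z.1 * g z.2) := by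
  have e : (fun z : α × γ => ENNReal.ofReal (f z.1 * g z.2)) =
      fun z => ENNReal.ofReal (f z.1) * ENNReal.ofReal (g z.2) := by
    ext z; rw [ENNReal.ofReal_mul (hf0 _)]
  have hI := ofReal_integral_eq_lintegral_ofReal hfi (Eventually.of_forall hf0)
  simp only [normalizedDensity]
  rw [e, lintegral_prod_mul hf.ennreal_ofReal.aemeasurable hg.ennreal_ofReal.aemeasurable,
    ← prod_withDensity hf.ennreal_ofReal hg.ennreal_ofReal, Measure.prod_smul_left,
    Measure.prod_smul_right, smul_smul, ENNReal.mul_inv]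
  · left; rw [← hI]; simpa using hfpos
  · left; rw [← hI]; exact ENNReal.ofReal_ne_top

/-- **Scheffé's lemma** for normalized densities: dominated pointwise convergence of the
unnormalized densities gives convergence in total variation. -/
theorem tvClose_normalizedDensity {μ : Measure α} {f : ℝ → α → ℝ} {g G : α → ℝ}
    (hf : ∀ b, Measurable (f b)) (hf0 : ∀ b, 0 ≤ f b) (hG : Integrable G μ)
    (hle : ∀ᶠ b in atTop, ∀ x, f b x ≤ G x)
    (hlim : ∀ x, Tendsto (fun b => f b x) atTop (𝓝 (g x)))
    (hgm : Measurable g) (hpos : 0 < ∫ x, g x ∂μ) :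
    TVClose (fun b => normalizedDensity μ (f b)) (fun _ => normalizedDensity μ g) := by
  have hg0 : 0 ≤ g := fun x => ge_of_tendsto' (hlim x) fun b => hf0 b x
  have hgG : ∀ x, g x ≤ G x := fun x =>
    le_of_tendsto (hlim x) (hle.mono fun b hb => hb x)
  have hgi : Integrable g μ := hG.mono' hgm.aestronglyMeasurable
    (Eventually.of_forall fun x => by rw [Real.norm_of_nonneg (hg0 x)]; exact hgG x)
  have hD : Tendsto (fun b => ∫ x, |f b x - g x| ∂μ) atTop (𝓝 0) := by
    have h := tendsto_integral_filter_of_dominated_convergence (μ := μ) (l := atTop)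
      (F := fun b x => |f b x - g x|) (f := fun _ => (0 : ℝ)) (fun x => G x)
      (Eventually.of_forall fun b => ((hf b).sub hgm).abs.aestronglyMeasurable)
      (hle.mono fun b hb => Eventually.of_forall fun x => by
        have := hb x; have := hf0 b x; have := hg0 x; have := hgG x
        simp only [Pi.zero_apply] at *
        rw [Real.norm_eq_abs, abs_abs, abs_le]; constructor <;> linarith) hG
      (Eventually.of_forall fun x => by
        have := ((hlim x).sub_const (g x)).abs
        simpa using this)
    simpa using h
  intro ε hε
  -- The L¹ error is paid twice below, once in the numerator and once in the normalizing constant;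
  -- hence the factor 1/2.
  have hZ : 0 < ε * (∫ x, g x ∂μ) / 2 := by positivity
  filter_upwards [hle, hD.eventually_lt_const hZ, hD.eventually_lt_const hpos]
    with b hb hDb hDb' B hB
  have hfi : Integrable (f b) μ := hG.mono' (hf b).aestronglyMeasurable
    (Eventually.of_forall fun x => by rw [Real.norm_of_nonneg (hf0 b x)]; exact hb x)
  rw [normalizedDensity_real (hf0 b) hfi hB, normalizedDensity_real hg0 hgi hB]
  have key : ∀ C : Set α, |∫ x in C, f b x ∂μ - ∫ x in C, g x ∂μ| ≤ ∫ x, |f b x - g x| ∂μ := by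
    intro C
    rw [← integral_sub hfi.integrableOn hgi.integrableOn]
    exact (abs_integral_le_integral_abs).trans (setIntegral_le_integral (hfi.sub hgi).abs
      (Eventually.of_forall fun x => abs_nonneg _))
  have k1 := key B
  have k2 := key Set.univ
  simp only [Measure.restrict_univ] at k2
  have h1 : ∫ x in B, f b x ∂μ ≤ ∫ x, f b x ∂μ :=
    setIntegral_le_integral hfi (Eventually.of_forall (hf0 b))
  have h0 : 0 ≤ ∫ x in B, f b x ∂μ := setIntegral_nonneg hB fun x _ => hf0 b x
  generalize (∫ x in B, f b x ∂μ) = s at *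
  generalize (∫ x in B, g x ∂μ) = t at *
  generalize (∫ x, f b x ∂μ) = F at *
  generalize (∫ x, g x ∂μ) = H at *
  generalize (∫ x, |f b x - g x| ∂μ) = D at *
  have hF : 0 < F := by linarith [(abs_le.1 k2).1]
  have e : s / F - t / H = (s / F * (H - F) + (s - t)) / H := by field_simp; ring
  have hr0 : 0 ≤ s / F := div_nonneg h0 hF.le
  have hr1 : s / F ≤ 1 := (div_le_one hF).2 h1
  rw [e, abs_div, abs_of_pos hpos, div_le_iff₀ hpos]
  calc |s / F * (H - F) + (s - t)| ≤ |s / F * (H - F)| + |s - t| := abs_add_le _ _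
    _ ≤ 1 * D + D := by
        rw [abs_mul, abs_of_nonneg hr0, abs_sub_comm H F]
        gcongr
    _ ≤ ε * H := by linarith

end NormalizedDensity

/-! ### Total variation under maps and products. -/

section TotalVariation

variable {E E' : Type*} [MeasurableSpace E] [MeasurableSpace E']

theorem TVClose.congr {μ μ' ν : ℝ → Measure E} (h : TVClose μ ν)
    (hμ : ∀ᶠ b in atTop, μ' b = μ b) : TVClose μ' ν := by
  intro ε hε
  filter_upwards [h ε hε, hμ] with b hb e B hB
  rw [e]; exact hb B hB

theorem TVClose.symm {μ ν : ℝ → Measure E} (h : TVClose μ ν) : TVClose ν μ := by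
  intro ε hε
  filter_upwards [h ε hε] with b hb B hB
  rw [abs_sub_comm]; exact hb B hB

theorem TVClose.trans {μ ν ρ : ℝ → Measure E} (h : TVClose μ ν) (h' : TVClose ν ρ) :
    TVClose μ ρ := by
  intro ε hε
  filter_upwards [h (ε / 2) (half_pos hε), h' (ε / 2) (half_pos hε)] with b hb hb' B hB
  calc |(μ b).real B - (ρ b).real B| ≤ _ := abs_sub_le _ ((ν b).real B) _
    _ ≤ ε / 2 + ε / 2 := add_le_add (hb B hB) (hb' B hB)
    _ = ε := add_halves ε

theorem TVClose.map {μ ν : ℝ → Measure E} (h : TVClose μ ν) {f : E → E'} (hf : Measurable f) :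
    TVClose (fun b => (μ b).map f) (fun b => (ν b).map f) := by
  intro ε hε
  filter_upwards [h ε hε] with b hb B hB
  rw [map_measureReal_apply hf hB, map_measureReal_apply hf hB]
  exact hb _ (hf hB)

theorem measureReal_prod_eq_integral {μ : Measure E} {ν : Measure E'} [IsProbabilityMeasure μ]
    [IsProbabilityMeasure ν] {B : Set (E × E')} (hB : MeasurableSet B) :
    (μ.prod ν).real B = ∫ x, ν.real (Prod.mk x ⁻¹' B) ∂μ := by
  rw [measureReal_def, Measure.prod_apply hB, ← integral_toReal]
  · rfl
  · exact (measurable_measure_prodMk_left hB).aemeasurable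
  · exact Eventually.of_forall fun x => measure_lt_top _ _

/-- By Fubini, both sides are averages over `μ` of the measures of the slices of `B`, and the bound
holds slice by slice. -/
theorem abs_measureReal_prod_sub_le {μ : Measure E} {ν ν' : Measure E'} [IsProbabilityMeasure μ]
    [IsProbabilityMeasure ν] [IsProbabilityMeasure ν'] {ε : ℝ}
    (h : ∀ B, MeasurableSet B → |ν.real B - ν'.real B| ≤ ε) {B : Set (E × E')}
    (hB : MeasurableSet B) : |(μ.prod ν).real B - (μ.prod ν').real B| ≤ ε := by
  have hint : ∀ τ : Measure E', IsProbabilityMeasure τ →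
      Integrable (fun x => τ.real (Prod.mk x ⁻¹' B)) μ := fun τ _ =>
    Integrable.of_bound (measurable_measure_prodMk_left hB).ennreal_toReal.aestronglyMeasurable 1
      (Eventually.of_forall fun x => by
        rw [Real.norm_of_nonneg measureReal_nonneg]; exact measureReal_le_one)
  rw [measureReal_prod_eq_integral hB, measureReal_prod_eq_integral hB,
    ← integral_sub (hint ν inferInstance) (hint ν' inferInstance)]
  have := norm_integral_le_of_norm_le_const (μ := μ) (C := ε)
    (f := fun x => ν.real (Prod.mk x ⁻¹' B) - ν'.real (Prod.mk x ⁻¹' B))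
    (Eventually.of_forall fun x => h _ (measurable_prodMk_left hB))
  simpa using this

theorem TVClose.prod {μ μ' : ℝ → Measure E} {ν ν' : ℝ → Measure E'} (h : TVClose μ μ')
    (h' : TVClose ν ν') (hμ : ∀ᶠ b in atTop, IsProbabilityMeasure (μ b))
    (hμ' : ∀ᶠ b in atTop, IsProbabilityMeasure (μ' b))
    (hν : ∀ᶠ b in atTop, IsProbabilityMeasure (ν b))
    (hν' : ∀ᶠ b in atTop, IsProbabilityMeasure (ν' b)) :
    TVClose (fun b => (μ b).prod (ν b)) (fun b => (μ' b).prod (ν' b)) := by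
  -- The factors are replaced one at a time; the first factor is reduced to the second by swapping
  -- coordinates.
  refine TVClose.trans (ν := fun b => (μ b).prod (ν' b)) ?_ ?_
  · intro ε hε
    filter_upwards [h' ε hε, hμ, hν, hν'] with b hb _ _ _ B hB
    exact abs_measureReal_prod_sub_le hb hB
  · intro ε hε
    filter_upwards [h ε hε, hμ, hμ', hν'] with b hb _ _ _ B hB
    have := abs_measureReal_prod_sub_le (μ := ν' b) hb (measurable_swap hB)
    rwa [← map_measureReal_apply measurable_swap hB, ← map_measureReal_apply measurable_swap hB,
      Measure.prod_swap, Measure.prod_swap] at this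

/-- If the joint law of `(U b, V b)` converges in total variation to a product of probability
measures, then `U b` and `V b` are asymptotically independent and their laws converge. -/
theorem asympIndep_of_tvClose_prod {Ω : ℝ → Type*} [∀ b, MeasurableSpace (Ω b)]
    {P : ∀ b, Measure (Ω b)} [∀ b, IsProbabilityMeasure (P b)] {U : ∀ b, Ω b → E}
    {V : ∀ b, Ω b → E'} (hU : ∀ᶠ b in atTop, AEMeasurable (U b) (P b))
    (hV : ∀ᶠ b in atTop, AEMeasurable (V b) (P b)) {ρ : Measure E} {σ : Measure E'}
    [IsProbabilityMeasure ρ] [IsProbabilityMeasure σ]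
    (h : TVClose (fun b => (P b).map fun ω => (U b ω, V b ω)) (fun _ => ρ.prod σ)) :
    AsympIndep P U V ∧ TVClose (fun b => (P b).map (U b)) (fun _ => ρ) ∧
      TVClose (fun b => (P b).map (V b)) (fun _ => σ) := by
  have h1 : TVClose (fun b => (P b).map (U b)) (fun _ => ρ) := by
    have := h.map measurable_fst
    simp only [Measure.map_fst_prod, measure_univ, one_smul] at this
    refine this.congr ?_
    filter_upwards [hU, hV] with b hu hv
    rw [AEMeasurable.map_map_of_aemeasurable measurable_fst.aemeasurable (hu.prodMk hv)]
    rfl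
  have h2 : TVClose (fun b => (P b).map (V b)) (fun _ => σ) := by
    have := h.map measurable_snd
    simp only [Measure.map_snd_prod, measure_univ, one_smul] at this
    refine this.congr ?_
    filter_upwards [hU, hV] with b hu hv
    rw [AEMeasurable.map_map_of_aemeasurable measurable_snd.aemeasurable (hu.prodMk hv)]
    rfl
  refine ⟨?_, h1, h2⟩
  -- Both the joint law and the product of its marginals are compared with `ρ.prod σ`.
  refine h.trans (TVClose.symm ?_)
  refine h1.prod h2 ?_ (Eventually.of_forall fun _ => inferInstance) ?_
    (Eventually.of_forall fun _ => inferInstance)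
  · filter_upwards [hU] with b hb using Measure.isProbabilityMeasure_map hb
  · filter_upwards [hV] with b hb using Measure.isProbabilityMeasure_map hb

end TotalVariation

/-! ### Integrability of the dominating exponentials. -/

section ExponentialIntegrability

theorem integrable_exp_neg_mul_abs {a : ℝ} (ha : 0 < a) :
    Integrable fun x : ℝ => Real.exp (-(a * |x|)) := by
  rw [← integrableOn_univ, ← Set.Iic_union_Ioi (a := (0 : ℝ)), integrableOn_union]
  constructor
  · refine (integrableOn_exp_mul_Iic ha 0).congr_fun (fun x hx => ?_) measurableSet_Iic
    simp only
    rw [abs_of_nonpos hx]; ring_nf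
  · refine (integrableOn_exp_mul_Ioi (neg_lt_zero.2 ha) 0).congr_fun (fun x hx => ?_)
      measurableSet_Ioi
    simp only
    rw [abs_of_pos hx]; ring_nf

theorem integrable_exp_neg_mul_sum_abs {ι : Type*} [Fintype ι] {a : ℝ} (ha : 0 < a) :
    Integrable fun x : ι → ℝ => Real.exp (-(a * ∑ i, |x i|)) := by
  have := Integrable.fintype_prod (ι := ι) (μ := fun _ => (volume : Measure ℝ))
    (f := fun _ x => Real.exp (-(a * |x|))) fun _ => integrable_exp_neg_mul_abs ha
  refine this.congr (Eventually.of_forall fun x => ?_)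
  simp only
  rw [← Real.exp_sum, Finset.mul_sum, Finset.sum_neg_distrib]

end ExponentialIntegrability

/-! ### Comparison of `‖B v‖` with the ℓ¹ norm of `v`. -/

section EuclideanNorm

variable {ι m : Type*} [Fintype ι] [Fintype m]

theorem euclNorm_sq (v : ι → ℝ) : euclNorm v ^ 2 = v ⬝ᵥ v := by
  rw [euclNorm, EuclideanSpace.real_norm_sq_eq, dotProduct]
  exact Finset.sum_congr rfl fun i _ => sq _

theorem euclNorm_nonneg (v : ι → ℝ) : 0 ≤ euclNorm v := norm_nonneg _

theorem euclNorm_smul (c : ℝ) (v : ι → ℝ) : euclNorm (c • v) = |c| * euclNorm v := by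
  rw [euclNorm, WithLp.toLp_smul, norm_smul, Real.norm_eq_abs, euclNorm]

theorem euclNorm_sub_le_euclNorm_add (v w : ι → ℝ) : euclNorm w - euclNorm v ≤ euclNorm (v + w) := by
  have := norm_sub_le (WithLp.toLp 2 (v + w)) (WithLp.toLp 2 v)
  rw [← WithLp.toLp_sub, add_sub_cancel_left] at this
  simp only [euclNorm]; linarith

theorem continuous_euclNorm : Continuous (euclNorm : (ι → ℝ) → ℝ) :=
  continuous_norm.comp (PiLp.continuous_toLp 2 _)

/-- The linear map `v ↦ B v` into Euclidean space. -/
def euclMulVec (B : Matrix m ι ℝ) : (ι → ℝ) →ₗ[ℝ] EuclideanSpace ℝ m :=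
  (WithLp.linearEquiv 2 ℝ (m → ℝ)).symm.toLinearMap ∘ₗ B.mulVecLin

theorem norm_euclMulVec (B : Matrix m ι ℝ) (v : ι → ℝ) : ‖euclMulVec B v‖ = euclNorm (B *ᵥ v) :=
  rfl

theorem exists_euclNorm_mulVec_le (B : Matrix m ι ℝ) :
    ∃ M, 0 ≤ M ∧ ∀ v, euclNorm (B *ᵥ v) ≤ M * ∑ i, |v i| := by
  refine ⟨‖(euclMulVec B).toContinuousLinearMap‖, norm_nonneg _, fun v => ?_⟩
  rw [← norm_euclMulVec]
  refine ((euclMulVec B).toContinuousLinearMap.le_opNorm v).trans ?_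
  gcongr
  refine (pi_norm_le_iff_of_nonneg (Finset.sum_nonneg fun i _ => abs_nonneg _)).2 fun i => ?_
  exact Finset.single_le_sum (f := fun i => |v i|) (fun i _ => abs_nonneg _) (Finset.mem_univ i)

/-- An invertible Gram matrix makes `B` injective, and an injective linear map in finite dimension
is bounded below. -/
theorem exists_le_euclNorm_mulVec [DecidableEq ι] {B : Matrix m ι ℝ} (hB : IsUnit (Bᵀ * B)) :
    ∃ δ, 0 < δ ∧ ∀ v, δ * ∑ i, |v i| ≤ euclNorm (B *ᵥ v) := by
  have hinj : LinearMap.ker (euclMulVec B) = ⊥ := by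
    rw [LinearMap.ker_eq_bot']
    intro v hv
    have h0 : B *ᵥ v = 0 := by
      have : WithLp.toLp 2 (B *ᵥ v) = 0 := hv
      simpa using this
    have h1 : (Bᵀ * B) *ᵥ v = (Bᵀ * B) *ᵥ 0 := by
      rw [← mulVec_mulVec, h0, mulVec_zero, mulVec_zero]
    exact (mulVec_injective_iff_isUnit.2 hB) h1
  obtain ⟨L, hL, hanti⟩ := LinearMap.exists_antilipschitzWith _ hinj
  have hL' : (0 : ℝ) < L := hL
  -- The sum is at most `card ι` times the sup norm; the `+ 1` keeps the constant positive when `ι`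
  -- is empty.
  refine ⟨(Fintype.card ι * L + 1)⁻¹, by positivity, fun v => ?_⟩
  rw [inv_mul_le_iff₀ (by positivity), ← norm_euclMulVec]
  have hv : ‖v‖ ≤ L * ‖euclMulVec B v‖ := by
    simpa using hanti.le_mul_dist v 0
  calc ∑ i, |v i| ≤ ∑ _i : ι, ‖v‖ := Finset.sum_le_sum fun i _ => norm_le_pi_norm v i
    _ = Fintype.card ι * ‖v‖ := by simp
    _ ≤ Fintype.card ι * (L * ‖euclMulVec B v‖) := by gcongr
    _ ≤ (Fintype.card ι * L + 1) * ‖euclMulVec B v‖ := by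
        have := norm_nonneg (euclMulVec B v); linarith

end EuclideanNorm

variable {n p : ℕ}

/-! ### Expansion of the objective and optimality conditions. -/

section Optimality

/-- The gap `|x + h| - |x| - ξ h` in the subgradient inequality of the absolute value. -/
def subgradGap (x ξ h : ℝ) : ℝ := |x + h| - |x| - ξ * h

theorem subgradGap_zero_left (ξ h : ℝ) : subgradGap 0 ξ h = |h| - ξ * h := by
  simp [subgradGap]

theorem subgradGap_nonneg {x ξ : ℝ} (hξ : |ξ| ≤ 1) (hx : ξ * x = |x|) (h : ℝ) :
    0 ≤ subgradGap x ξ h := by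
  have h1 : ξ * (x + h) ≤ |x + h| := (le_abs_self _).trans <| by
    rw [abs_mul]; exact mul_le_of_le_one_left (abs_nonneg _) hξ
  rw [subgradGap]; linarith

/-- Convexity of the gap in `h`, which vanishes at `h = 0`. -/
theorem subgradGap_mul_le (x ξ h : ℝ) {s : ℝ} (h0 : 0 ≤ s) (h1 : s ≤ 1) :
    subgradGap x ξ (s * h) ≤ s * subgradGap x ξ h := by
  have : |x + s * h| ≤ s * |x + h| + (1 - s) * |x| := by
    have e : x + s * h = s * (x + h) + (1 - s) * x := by ring
    rw [e]
    refine (abs_add_le _ _).trans ?_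
    rw [abs_mul, abs_mul, abs_of_nonneg h0, abs_of_nonneg (sub_nonneg.2 h1)]
  simp only [subgradGap]; linarith

theorem objective_add (A : Matrix (Fin n) (Fin p) ℝ) (y : Fin n → ℝ) (x h : Fin p → ℝ) :
    objective A y (x + h) - objective A y x =
      ∑ i, subgradGap (x i) (dual A y x i) (h i) + euclNorm (A *ᵥ h) ^ 2 / 2 := by
  have e1 : A *ᵥ (x + h) - y = (A *ᵥ x - y) + A *ᵥ h := by rw [mulVec_add]; abel
  have e2 : ∑ i, dual A y x i * h i = -((A *ᵥ x - y) ⬝ᵥ (A *ᵥ h)) := by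
    change dual A y x ⬝ᵥ h = _
    rw [dual, mulVec_transpose, ← dotProduct_mulVec, ← neg_dotProduct, neg_sub]
  have e3 : ∑ i, subgradGap (x i) (dual A y x i) (h i) =
      ∑ i, |x i + h i| - ∑ i, |x i| - ∑ i, dual A y x i * h i := by
    simp only [subgradGap, Finset.sum_sub_distrib]
  rw [e3, e2, objective, objective, e1, euclNorm_sq, euclNorm_sq, euclNorm_sq, add_dotProduct,
    dotProduct_add, dotProduct_add, dotProduct_comm (A *ᵥ h) (A *ᵥ x - y)]
  simp only [Pi.add_apply]
  ring

theorem continuous_objective (A : Matrix (Fin n) (Fin p) ℝ) (y : Fin n → ℝ) :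
    Continuous (objective A y) := by
  have h : Continuous fun x : Fin p → ℝ => euclNorm (A *ᵥ x - y) :=
    continuous_euclNorm.comp (by fun_prop)
  unfold objective
  fun_prop

variable {A : Matrix (Fin n) (Fin p) ℝ} {y : Fin n → ℝ} {xs : Fin p → ℝ}

/-- Move only coordinate `i`, by `s t`: minimality and convexity give `0 ≤ gap + s q` after division
by `s`, and `s → 0` removes the quadratic term. -/
theorem IsLasso.subgradGap_nonneg (hxs : IsLasso A y xs) (i : Fin p) (t : ℝ) :
    0 ≤ subgradGap (xs i) (dual A y xs i) t := by
  set q := euclNorm (A *ᵥ Pi.single i t) ^ 2 / 2 with hq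
  have key : ∀ s : ℝ, 0 < s → s ≤ 1 → 0 ≤ subgradGap (xs i) (dual A y xs i) t + s * q := by
    intro s hs hs1
    have h := hxs (xs + s • Pi.single i t)
    have h' := objective_add A y xs (s • Pi.single i t)
    rw [mulVec_smul, euclNorm_smul, Finset.sum_eq_single i (fun j _ hj => by
      simp [subgradGap, hj]) (by simp), mul_pow, sq_abs] at h'
    simp only [Pi.smul_apply, Pi.single_eq_same, smul_eq_mul] at h'
    have hle := subgradGap_mul_le (xs i) (dual A y xs i) t hs.le hs1
    have : 0 ≤ s * (subgradGap (xs i) (dual A y xs i) t + s * q) := by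
      have e : s ^ 2 * euclNorm (A *ᵥ Pi.single i t) ^ 2 / 2 = s * (s * q) := by rw [hq]; ring
      rw [e] at h'
      rw [mul_add]; linarith
    exact nonneg_of_mul_nonneg_right this hs
  have hlim : Tendsto (fun s : ℝ => subgradGap (xs i) (dual A y xs i) t + s * q) (𝓝[>] 0)
      (𝓝 (subgradGap (xs i) (dual A y xs i) t + 0 * q)) :=
    ((continuous_const.add (continuous_id.mul continuous_const)).tendsto 0).mono_left
      nhdsWithin_le_nhds
  rw [zero_mul, add_zero] at hlim
  refine ge_of_tendsto hlim ?_
  filter_upwards [Ioc_mem_nhdsGT (zero_lt_one (α := ℝ))] with s hs using key s hs.1 hs.2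

theorem IsLasso.abs_dual_le_one (hxs : IsLasso A y xs) (i : Fin p) : |dual A y xs i| ≤ 1 := by
  -- The increments move the coordinate to `1`, `-1`, `2 x_i` and `0`; the last two force `ξ_i x_i =
  -- |x_i|`, and the first two then give `ξ_i ≤ 1` and `-1 ≤ ξ_i`.
  have h1 := hxs.subgradGap_nonneg i (-xs i + 1)
  have h2 := hxs.subgradGap_nonneg i (-xs i - 1)
  have h3 := hxs.subgradGap_nonneg i (xs i)
  have h4 := hxs.subgradGap_nonneg i (-xs i)
  simp only [subgradGap] at *
  rw [show xs i + (-xs i + 1) = 1 by ring, abs_one] at h1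
  rw [show xs i + (-xs i - 1) = -1 by ring, abs_neg, abs_one] at h2
  rw [← two_mul, abs_mul, abs_two] at h3
  rw [add_neg_cancel, abs_zero] at h4
  rw [abs_le]; constructor <;> linarith

theorem IsLasso.dual_mul_self (hxs : IsLasso A y xs) (i : Fin p) :
    dual A y xs i * xs i = |xs i| := by
  have h3 := hxs.subgradGap_nonneg i (xs i)
  have h4 := hxs.subgradGap_nonneg i (-xs i)
  simp only [subgradGap] at *
  rw [← two_mul, abs_mul, abs_two] at h3
  rw [add_neg_cancel, abs_zero] at h4
  linarith

/-- On the support, `ξ_i x_i = |x_i|` forces `|ξ_i| = 1`. This turns the invertibility assumption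
into one about the block `V`. -/
theorem IsLasso.bdryI_eq (hxs : IsLasso A y xs) : bdryI A y xs = supp xs ∪ bdryI0 A y xs := by
  ext i
  simp only [bdryI, supp, bdryI0, Finset.mem_union, Finset.mem_filter, Finset.mem_univ, true_and]
  by_cases h : xs i = 0
  · simp [h]
  · have := congrArg abs (hxs.dual_mul_self i)
    rw [abs_mul, abs_abs] at this
    simp [h, mul_right_cancel₀ (abs_ne_zero.2 h) (this.trans (one_mul _).symm)]

end Optimality

/-! ### Splitting a vector into two blocks. -/

section Blocks

/-- The vector of `ℝ^p` whose blocks on `K` and `J` are `a u` and `b v`. -/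
def glue (K J : Finset (Fin p)) (a b : ℝ) (z : (K → ℝ) × (J → ℝ)) : Fin p → ℝ := fun i =>
  if h : i ∈ K then a * z.1 ⟨i, h⟩ else if h : i ∈ J then b * z.2 ⟨i, h⟩ else 0

variable {K J : Finset (Fin p)}

theorem glue_left (a b : ℝ) (z : (K → ℝ) × (J → ℝ)) (i : K) : glue K J a b z i = a * z.1 i := by
  simp [glue]

theorem glue_right (hd : Disjoint K J) (a b : ℝ) (z : (K → ℝ) × (J → ℝ)) (i : J) :
    glue K J a b z i = b * z.2 i := by
  have : (i : Fin p) ∉ K := Finset.disjoint_right.1 hd i.2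
  simp [glue, this]

theorem sum_blocks (hd : Disjoint K J) (hu : K ∪ J = Finset.univ) (φ : Fin p → ℝ) :
    ∑ i, φ i = ∑ i : K, φ i + ∑ i : J, φ i := by
  rw [← hu, Finset.sum_union hd, Finset.sum_coe_sort K φ, Finset.sum_coe_sort J φ]

theorem mulVec_glue (hd : Disjoint K J) (hu : K ∪ J = Finset.univ)
    (A : Matrix (Fin n) (Fin p) ℝ) (a b : ℝ) (z : (K → ℝ) × (J → ℝ)) :
    A *ᵥ glue K J a b z = a • (cols A K *ᵥ z.1) + b • (cols A J *ᵥ z.2) := by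
  ext r
  simp only [mulVec, dotProduct, Pi.add_apply, Pi.smul_apply, smul_eq_mul, Finset.mul_sum, cols,
    submatrix_apply, id]
  rw [sum_blocks hd hu]
  simp only [glue_left, glue_right hd]
  congr 1 <;> exact Finset.sum_congr rfl fun i _ => by ring

theorem continuous_glue (a b : ℝ) : Continuous (glue K J a b) := by
  refine continuous_pi fun i => ?_
  unfold glue
  by_cases h : i ∈ K
  · simp only [h, dite_true]; fun_prop
  · by_cases h' : i ∈ J
    · simp only [h, h', dite_true, dite_false]; fun_prop
    · simp only [h, h', dite_false]; fun_prop

end Blocks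

/-! ### The rescaled objective and its uniform lower bound. -/

section RescaledGap

variable (A : Matrix (Fin n) (Fin p) ℝ) (y : Fin n → ℝ) (xs : Fin p → ℝ)

/-- `β (F(x + h) - F(x))`, where `h` has the blocks `u / β` on `K` and `v / √β` on `J`. -/
def rescaledGap (K J : Finset (Fin p)) (β : ℝ) (z : (K → ℝ) × (J → ℝ)) : ℝ :=
  β * (objective A y (xs + glue K J β⁻¹ (√β)⁻¹ z) - objective A y xs)

theorem continuous_rescaledGap (K J : Finset (Fin p)) (β : ℝ) :
    Continuous (rescaledGap A y xs K J β) := by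
  have h : Continuous fun z => objective A y (xs + glue K J β⁻¹ (√β)⁻¹ z) :=
    (continuous_objective A y).comp (continuous_const.add (continuous_glue _ _))
  unfold rescaledGap
  fun_prop

variable {A y xs} {K J : Finset (Fin p)}

/-- On `K` the gap at `0` is positively homogeneous, so the scale `1/β` absorbs `β` exactly; the
quadratic term is homogeneous of degree two, which leaves `1/√β` in front of the `K` part only. -/
theorem rescaledGap_eq (hd : Disjoint K J) (hu : K ∪ J = Finset.univ) (hK : ∀ i ∈ K, xs i = 0)
    {β : ℝ} (hβ : 0 < β) (z : (K → ℝ) × (J → ℝ)) :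
    rescaledGap A y xs K J β z = ∑ i : K, (|z.1 i| - dual A y xs i * z.1 i) +
      ∑ i : J, β * subgradGap (xs i) (dual A y xs i) ((√β)⁻¹ * z.2 i) +
      euclNorm ((√β)⁻¹ • (cols A K *ᵥ z.1) + cols A J *ᵥ z.2) ^ 2 / 2 := by
  have hs : 0 < √β := Real.sqrt_pos.2 hβ
  have hss : √β * √β = β := Real.mul_self_sqrt hβ.le
  have e : A *ᵥ glue K J β⁻¹ (√β)⁻¹ z =
      (√β)⁻¹ • ((√β)⁻¹ • (cols A K *ᵥ z.1) + cols A J *ᵥ z.2) := by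
    rw [mulVec_glue hd hu, smul_add, smul_smul, ← mul_inv, hss]
  rw [rescaledGap, objective_add, e, euclNorm_smul, sum_blocks hd hu, mul_add, mul_add,
    Finset.mul_sum, Finset.mul_sum]
  simp only [glue_left, glue_right hd]
  congr 1
  · congr 1
    refine Finset.sum_congr rfl fun i _ => ?_
    rw [hK i i.2, subgradGap_zero_left, abs_mul, abs_of_pos (inv_pos.2 hβ)]
    field_simp
  · rw [mul_pow, sq_abs, inv_pow, Real.sq_sqrt hβ.le]
    field_simp

theorem exists_pos_forall_le {ι : Type*} (s : Finset ι) {f : ι → ℝ} (h : ∀ i ∈ s, 0 < f i) :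
    ∃ c, 0 < c ∧ ∀ i ∈ s, c ≤ f i := by
  rcases s.eq_empty_or_nonempty with rfl | hs
  · exact ⟨1, one_pos, by simp⟩
  · obtain ⟨i, hi, hmin⟩ := s.exists_min_image f hs
    exact ⟨f i, h i hi, hmin⟩

/-- The rescaled objective is bounded below by a multiple of the `ℓ¹` norm, uniformly in
`β ≥ 1`. -/
theorem exists_le_rescaledGap (hxs : IsLasso A y xs) (hd : Disjoint K J)
    (hu : K ∪ J = Finset.univ) (hK : ∀ i ∈ K, xs i = 0) (hK' : ∀ i ∈ K, |dual A y xs i| ≠ 1)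
    (hJ : IsUnit ((cols A J)ᵀ * cols A J)) :
    ∃ c C : ℝ, 0 < c ∧ ∀ β, 1 ≤ β → ∀ z : (K → ℝ) × (J → ℝ),
      c * ∑ i, |z.1 i| + c * ∑ i, |z.2 i| - C ≤ rescaledGap A y xs K J β z := by
  obtain ⟨c, hc, hcK⟩ := exists_pos_forall_le K (f := fun i => 1 - |dual A y xs i|) fun i hi =>
    sub_pos.2 (lt_of_le_of_ne (hxs.abs_dual_le_one i) (hK' i hi))
  obtain ⟨M, hM, hMle⟩ := exists_euclNorm_mulVec_le (cols A K)
  obtain ⟨δ, hδ, hδle⟩ := exists_le_euclNorm_mulVec hJ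
  -- `t` is the slope of the tangent line used to bound `N ^ 2 / 2` below. It is small enough that
  -- the loss `t * M * a` from the `K` block uses only half of the gain `c * a`.
  obtain ⟨t, ht, htM⟩ : ∃ t : ℝ, 0 < t ∧ t * M ≤ c / 2 := by
    refine ⟨c / 2 / (M + 1), by positivity, ?_⟩
    rw [div_mul_eq_mul_div, div_le_iff₀ (by positivity)]
    gcongr; linarith
  refine ⟨min (c / 2) (t * δ), t ^ 2 / 2, by positivity, fun β hβ z => ?_⟩
  have hβ0 : 0 < β := one_pos.trans_le hβ
  rw [rescaledGap_eq hd hu hK hβ0]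
  set a := ∑ i, |z.1 i| with ha
  set b := ∑ i, |z.2 i| with hb
  have ha0 : 0 ≤ a := Finset.sum_nonneg fun i _ => abs_nonneg _
  have hb0 : 0 ≤ b := Finset.sum_nonneg fun i _ => abs_nonneg _
  have h1 : c * a ≤ ∑ i : K, (|z.1 i| - dual A y xs i * z.1 i) := by
    rw [ha, Finset.mul_sum]
    refine Finset.sum_le_sum fun i _ => ?_
    have h1 := mul_le_mul_of_nonneg_right (hcK i i.2) (abs_nonneg (z.1 i))
    have h2 := le_abs_self (dual A y xs i * z.1 i)
    rw [abs_mul] at h2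
    linarith
  have h2 : 0 ≤ ∑ i : J, β * subgradGap (xs i) (dual A y xs i) ((√β)⁻¹ * z.2 i) :=
    Finset.sum_nonneg fun i _ => mul_nonneg hβ0.le (hxs.subgradGap_nonneg _ _)
  set N := euclNorm ((√β)⁻¹ • (cols A K *ᵥ z.1) + cols A J *ᵥ z.2) with hN
  have h3 : δ * b - M * a ≤ N := by
    refine le_trans ?_ (euclNorm_sub_le_euclNorm_add _ _)
    refine sub_le_sub (hδle z.2) ?_
    rw [euclNorm_smul, abs_of_nonneg (by positivity)]
    refine (mul_le_of_le_one_left (euclNorm_nonneg _) ?_).trans (hMle z.1)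
    exact inv_le_one_of_one_le₀ (Real.one_le_sqrt.2 hβ)
  have h4 : t * N - t ^ 2 / 2 ≤ N ^ 2 / 2 := by linarith [sq_nonneg (N - t)]
  have h5 : t * (δ * b - M * a) ≤ t * N := mul_le_mul_of_nonneg_left h3 ht.le
  have h6 : t * M * a ≤ c / 2 * a := mul_le_mul_of_nonneg_right htM ha0
  have h7 : min (c / 2) (t * δ) * a ≤ c / 2 * a :=
    mul_le_mul_of_nonneg_right (min_le_left _ _) ha0
  have h8 : min (c / 2) (t * δ) * b ≤ t * δ * b :=
    mul_le_mul_of_nonneg_right (min_le_right _ _) hb0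
  linarith

end RescaledGap

/-! ### The limit densities and pointwise convergence. -/

section LimitDensities

variable {A : Matrix (Fin n) (Fin p) ℝ} {y : Fin n → ℝ} {xs : Fin p → ℝ} {κ : ℝ}

theorem laplaceDensity_eq (u : ↥(I0 xs \ bdryI0 A y xs) → ℝ) :
    laplaceDensity A y xs κ u = Real.exp (-(κ * ∑ i, (|u i| - dual A y xs i * u i))) := by
  rw [laplaceDensity, ← Real.exp_sum, Finset.mul_sum, ← Finset.sum_neg_distrib]
  congr 1
  refine Finset.sum_congr rfl fun i _ => ?_
  have : |u i| * Real.sign (u i) = u i := by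
    rcases lt_trichotomy (u i) 0 with h | h | h
    · rw [Real.sign_of_neg h, abs_of_neg h]; ring
    · simp [h]
    · rw [Real.sign_of_pos h, abs_of_pos h, mul_one]
  rw [mul_sub, ← mul_assoc, this, mul_one, mul_comm (u i)]

theorem continuous_laplaceDensity : Continuous (laplaceDensity A y xs κ) := by
  rw [funext laplaceDensity_eq]
  fun_prop

theorem laplaceDensity_pos (u : ↥(I0 xs \ bdryI0 A y xs) → ℝ) :
    0 < laplaceDensity A y xs κ u := by
  rw [laplaceDensity_eq]; exact Real.exp_pos _

theorem measurable_gaussDensity : Measurable (gaussDensity A y xs κ) := by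
  refine Measurable.indicator ?_ ?_
  · have h : Continuous fun v : ↥(supp xs ∪ bdryI0 A y xs) → ℝ =>
        euclNorm (cols A (supp xs ∪ bdryI0 A y xs) *ᵥ v) := continuous_euclNorm.comp (by fun_prop)
    exact Continuous.measurable (by fun_prop)
  · simp only [Set.ofPred_forall]
    refine MeasurableSet.iInter fun i => MeasurableSet.iInter fun _ => ?_
    exact measurableSet_le measurable_const (by fun_prop)

theorem gaussDensity_nonneg : 0 ≤ gaussDensity A y xs κ :=
  Set.indicator_nonneg fun _ _ => (Real.exp_pos _).le

theorem gaussDensity_zero : gaussDensity A y xs κ 0 = 1 := by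
  rw [gaussDensity, Set.indicator_of_mem (by simp)]
  simp [euclNorm_sq]

theorem laplaceDensity_zero : laplaceDensity A y xs κ 0 = 1 := by
  simp [laplaceDensity_eq]

theorem integral_laplaceDensity_pos (hi : Integrable (laplaceDensity A y xs κ)) :
    0 < ∫ u, laplaceDensity A y xs κ u := by
  rw [integral_pos_iff_support_of_nonneg (fun u => (laplaceDensity_pos u).le) hi]
  have : Function.support (laplaceDensity A y xs κ) = Set.univ :=
    Set.eq_univ_of_forall fun u => (laplaceDensity_pos u).ne'
  rw [this]
  exact isOpen_univ.measure_pos _ Set.univ_nonempty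

theorem integral_gaussDensity_pos (hi : Integrable (gaussDensity A y xs κ)) :
    0 < ∫ v, gaussDensity A y xs κ v := by
  rw [integral_pos_iff_support_of_nonneg gaussDensity_nonneg hi]
  let O : Set (↥(supp xs ∪ bdryI0 A y xs) → ℝ) :=
    ⋂ i : ↥(supp xs ∪ bdryI0 A y xs), ⋂ _ : (i : Fin p) ∈ bdryI0 A y xs,
      {v | 0 < dual A y xs i * v i}
  have hO : IsOpen O := isOpen_iInter_of_finite fun i => isOpen_iInter_of_finite fun _ =>
    isOpen_lt continuous_const (by fun_prop)
  have hne : O.Nonempty := by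
    -- `v = ξ` satisfies the constraints strictly, since `ξ_i ^ 2 > 0` on `∂I₀`.
    refine ⟨fun i => dual A y xs i, Set.mem_iInter₂.2 fun i hi => ?_⟩
    have h1 : |dual A y xs i| = 1 := (Finset.mem_filter.1 hi).2.2
    have h2 : dual A y xs i ≠ 0 := fun h => by simp [h] at h1
    exact mul_self_pos.2 h2
  refine (hO.measure_pos volume hne).trans_le (measure_mono fun v hv => ?_)
  have hv' : v ∈ {v : ↥(supp xs ∪ bdryI0 A y xs) → ℝ | ∀ i : ↥(supp xs ∪ bdryI0 A y xs),
      (i : Fin p) ∈ bdryI0 A y xs → 0 ≤ dual A y xs i * v i} := fun i hi =>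
    (Set.mem_iInter₂.1 hv i hi).le
  rw [Function.mem_support, gaussDensity, Set.indicator_of_mem hv']
  exact (Real.exp_pos _).ne'

theorem disjoint_blocks : Disjoint (I0 xs \ bdryI0 A y xs) (supp xs ∪ bdryI0 A y xs) := by
  rw [Finset.disjoint_left]
  intro i
  simp only [I0, supp, Finset.mem_sdiff, Finset.mem_union, Finset.mem_filter, Finset.mem_univ,
    true_and]
  tauto

theorem union_blocks : (I0 xs \ bdryI0 A y xs) ∪ (supp xs ∪ bdryI0 A y xs) = Finset.univ := by
  ext i
  simp only [I0, supp, Finset.mem_sdiff, Finset.mem_union, Finset.mem_filter, Finset.mem_univ,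
    true_and, iff_true]
  tauto

/-- A coordinate of the support contributes nothing to the rescaled gap in the limit. -/
theorem eventually_subgradGap_eq_zero {x ξ : ℝ} (hx : x ≠ 0) (hξ : ξ * x = |x|) (v : ℝ) :
    ∀ᶠ β : ℝ in atTop, subgradGap x ξ ((√β)⁻¹ * v) = 0 := by
  -- Positivity of this product says that the perturbed coordinate keeps the sign of `x`, for both
  -- signs at once.
  have hlim : Tendsto (fun β : ℝ => x * (x + (√β)⁻¹ * v)) atTop (𝓝 (x * (x + 0 * v))) :=
    ((Real.tendsto_sqrt_atTop.inv_tendsto_atTop.mul_const v).const_add x).const_mul x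
  have hpos : 0 < x * (x + 0 * v) := by simpa using mul_self_pos.2 hx
  filter_upwards [hlim.eventually_const_lt hpos] with β hβ
  generalize (√β)⁻¹ * v = h at *
  rw [subgradGap]
  rcases hx.lt_or_gt with hx' | hx'
  · have : ξ = -1 := by
      rw [abs_of_neg hx'] at hξ; exact mul_right_cancel₀ hx (by linarith)
    rw [abs_of_neg (neg_of_mul_pos_right hβ hx'.le), abs_of_neg hx', this]; ring
  · have : ξ = 1 := by
      rw [abs_of_pos hx'] at hξ; exact mul_right_cancel₀ hx (by linarith)
    rw [abs_of_pos (pos_of_mul_pos_right hβ hx'.le), abs_of_pos hx', this]; ring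

theorem mul_subgradGap_zero {β : ℝ} (hβ : 0 < β) (ξ v : ℝ) :
    β * subgradGap 0 ξ ((√β)⁻¹ * v) = √β * (|v| - ξ * v) := by
  have hs : 0 < √β := Real.sqrt_pos.2 hβ
  have hss : β = √β * √β := (Real.mul_self_sqrt hβ.le).symm
  rw [subgradGap_zero_left, abs_mul, abs_of_pos (inv_pos.2 hs)]
  nth_rewrite 1 [hss]
  field_simp

theorem tendsto_exp_rescaledGap (hxs : IsLasso A y xs) (hκ : 0 < κ)
    (z : (↥(I0 xs \ bdryI0 A y xs) → ℝ) × (↥(supp xs ∪ bdryI0 A y xs) → ℝ)) :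
    Tendsto (fun β => Real.exp (-(κ * rescaledGap A y xs (I0 xs \ bdryI0 A y xs)
      (supp xs ∪ bdryI0 A y xs) β z))) atTop
      (𝓝 (laplaceDensity A y xs κ z.1 * gaussDensity A y xs κ z.2)) := by
  have hK : ∀ i ∈ I0 xs \ bdryI0 A y xs, xs i = 0 := fun i hi =>
    (Finset.mem_filter.1 (Finset.mem_sdiff.1 hi).1).2
  have hbd : ∀ i, i ∈ bdryI0 A y xs ↔ xs i = 0 ∧ |dual A y xs i| = 1 := fun i => by
    simp [bdryI0]
  by_cases hv : ∀ i : ↥(supp xs ∪ bdryI0 A y xs), (i : Fin p) ∈ bdryI0 A y xs →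
      0 ≤ dual A y xs i * z.2 i
  · have hg : gaussDensity A y xs κ z.2 =
        Real.exp (-(κ * (euclNorm (cols A (supp xs ∪ bdryI0 A y xs) *ᵥ z.2) ^ 2 / 2))) :=
      Set.indicator_of_mem (s := {v : ↥(supp xs ∪ bdryI0 A y xs) → ℝ |
        ∀ i : ↥(supp xs ∪ bdryI0 A y xs), (i : Fin p) ∈ bdryI0 A y xs →
          0 ≤ dual A y xs i * v i}) hv _
    rw [hg, laplaceDensity_eq, ← Real.exp_add, ← neg_add, ← mul_add]
    refine (Real.continuous_exp.tendsto _).comp ((Tendsto.const_mul κ ?_).neg)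
    -- Inside the constraint set `ξ_i v_i = |v_i|` on `∂I₀`, so no gap on `J` survives for large
    -- `β`.
    have hzero : ∀ᶠ β : ℝ in atTop, ∀ i : ↥(supp xs ∪ bdryI0 A y xs),
        β * subgradGap (xs i) (dual A y xs i) ((√β)⁻¹ * z.2 i) = 0 := by
      rw [eventually_all]
      intro i
      by_cases hi : xs i = 0
      · have hib : (i : Fin p) ∈ bdryI0 A y xs := by
          rcases Finset.mem_union.1 i.2 with h | h
          · exact absurd hi (Finset.mem_filter.1 h).2
          · exact h
        filter_upwards [eventually_gt_atTop 0] with β hβ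
        have h1 := abs_of_nonneg (hv i hib)
        rw [abs_mul, ((hbd i).1 hib).2, one_mul] at h1
        rw [hi, mul_subgradGap_zero hβ, h1, sub_self, mul_zero]
      · filter_upwards [eventually_subgradGap_eq_zero hi (hxs.dual_mul_self i) (z.2 i)] with β hβ
        rw [hβ, mul_zero]
    have hN : Tendsto (fun β : ℝ => euclNorm ((√β)⁻¹ • (cols A (I0 xs \ bdryI0 A y xs) *ᵥ z.1) +
        cols A (supp xs ∪ bdryI0 A y xs) *ᵥ z.2)) atTop
        (𝓝 (euclNorm ((0 : ℝ) • (cols A (I0 xs \ bdryI0 A y xs) *ᵥ z.1) +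
          cols A (supp xs ∪ bdryI0 A y xs) *ᵥ z.2))) :=
      (continuous_euclNorm.tendsto _).comp
        ((Real.tendsto_sqrt_atTop.inv_tendsto_atTop.smul_const _).add_const _)
    rw [zero_smul, zero_add] at hN
    refine (((hN.pow 2).div_const 2).const_add _).congr' ?_
    filter_upwards [hzero, eventually_gt_atTop 0] with β hβ hβ0
    rw [rescaledGap_eq disjoint_blocks union_blocks hK hβ0, Finset.sum_eq_zero fun i _ => hβ i,
      add_zero]
  · have hg : gaussDensity A y xs κ z.2 = 0 :=
      Set.indicator_of_notMem (s := {v : ↥(supp xs ∪ bdryI0 A y xs) → ℝ |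
        ∀ i : ↥(supp xs ∪ bdryI0 A y xs), (i : Fin p) ∈ bdryI0 A y xs →
          0 ≤ dual A y xs i * v i}) hv _
    rw [hg, mul_zero]
    push Not at hv
    obtain ⟨i, hib, hneg⟩ := hv
    -- A single violated constraint costs a positive multiple of `√β`, while all other terms are
    -- nonnegative.
    refine Real.tendsto_exp_neg_atTop_nhds_zero.comp (Tendsto.const_mul_atTop hκ ?_)
    have hc : 0 < |z.2 i| - dual A y xs i * z.2 i := by
      linarith [abs_nonneg (z.2 i)]
    refine tendsto_atTop_mono' _ ?_ (Real.tendsto_sqrt_atTop.atTop_mul_const hc)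
    filter_upwards [eventually_gt_atTop 0] with β hβ
    rw [rescaledGap_eq disjoint_blocks union_blocks hK hβ, ← mul_subgradGap_zero hβ,
      ← ((hbd i).1 hib).1]
    have h1 : 0 ≤ ∑ i : ↥(I0 xs \ bdryI0 A y xs), (|z.1 i| - dual A y xs i * z.1 i) :=
      Finset.sum_nonneg fun j _ => by
      have := hxs.subgradGap_nonneg j (z.1 j)
      rwa [hK j j.2, subgradGap_zero_left] at this
    have h2 := Finset.single_le_sum (f := fun i : ↥(supp xs ∪ bdryI0 A y xs) =>
        β * subgradGap (xs i) (dual A y xs i) ((√β)⁻¹ * z.2 i))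
      (fun j _ => mul_nonneg hβ.le (hxs.subgradGap_nonneg _ _)) (Finset.mem_univ i)
    have h3 : 0 ≤ euclNorm ((√β)⁻¹ • (cols A (I0 xs \ bdryI0 A y xs) *ᵥ z.1) +
        cols A (supp xs ∪ bdryI0 A y xs) *ᵥ z.2) ^ 2 / 2 := by positivity
    linarith

end LimitDensities

/-! ### Change of variables. -/

section ChangeOfVariables

variable {n p : ℕ} {K J : Finset (Fin p)}

/-- The rescaling `x ↦ (a x_K, b x_J)` as a continuous linear equivalence. -/
def blockScaling (hd : Disjoint K J) (hu : K ∪ J = Finset.univ) {a b : ℝ} (ha : a ≠ 0)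
    (hb : b ≠ 0) : (Fin p → ℝ) ≃L[ℝ] (K → ℝ) × (J → ℝ) :=
  LinearEquiv.toContinuousLinearEquiv
    { toFun := fun x => (fun i => a * x i, fun i => b * x i)
      map_add' := fun x y => by ext <;> simp [mul_add]
      map_smul' := fun c x => by ext <;> simp [mul_left_comm]
      invFun := glue K J a⁻¹ b⁻¹
      left_inv := fun x => by
        ext i
        by_cases h : i ∈ K
        · rw [glue_left _ _ _ ⟨i, h⟩]; exact inv_mul_cancel_left₀ ha _
        · have h' : i ∈ J := (Finset.mem_union.1 (hu ▸ Finset.mem_univ i)).resolve_left h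
          rw [glue_right hd _ _ _ ⟨i, h'⟩]; exact inv_mul_cancel_left₀ hb _
      right_inv := fun z => by
        ext i
        · simp [glue_left, ha]
        · simp [glue_right hd, hb] }

theorem blockScaling_symm_apply (hd : Disjoint K J) (hu : K ∪ J = Finset.univ) {a b : ℝ}
    (ha : a ≠ 0) (hb : b ≠ 0) (z : (K → ℝ) × (J → ℝ)) :
    (blockScaling hd hu ha hb).symm z = glue K J a⁻¹ b⁻¹ z := rfl

/-- Translation preserves the volume, and its image under `L` is a Haar measure, unique up to a
positive finite factor. -/
theorem exists_map_volume_eq_smul {E F : Type*} [NormedAddCommGroup E] [NormedSpace ℝ E]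
    [MeasureSpace E] [BorelSpace E] [(volume : Measure E).IsAddHaarMeasure]
    [NormedAddCommGroup F] [NormedSpace ℝ F] [FiniteDimensional ℝ F] [MeasureSpace F]
    [BorelSpace F] [(volume : Measure F).IsAddHaarMeasure] (L : E ≃L[ℝ] F) (x : E) :
    ∃ c : ENNReal, c ≠ 0 ∧ c ≠ ⊤ ∧
      (volume : Measure E).map (fun h => L (h - x)) = c • (volume : Measure F) := by
  have h1 : (volume : Measure E).map (fun h => L (h - x)) = (volume : Measure E).map L := by
    have : (fun h => L (h - x)) = L ∘ fun h => h - x := rfl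
    rw [this, ← Measure.map_map L.continuous.measurable (continuous_sub_right x).measurable,
      map_sub_right_eq_self]
  have : ((volume : Measure E).map L).IsAddHaarMeasure := L.isAddHaarMeasure_map volume
  have h2 := Measure.isAddLeftInvariant_eq_smul ((volume : Measure E).map L) (volume : Measure F)
  refine ⟨_, ?_, ?_, h1.trans h2⟩
  · exact_mod_cast (Measure.addHaarScalarFactor_pos_of_isAddHaarMeasure _ _).ne'
  · exact ENNReal.coe_ne_top

/-- The law of the rescaled blocks under the posterior. -/
theorem map_posterior (hd : Disjoint K J) (hu : K ∪ J = Finset.univ)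
    (A : Matrix (Fin n) (Fin p) ℝ) (y : Fin n → ℝ) (κ : ℝ) (xs : Fin p → ℝ)
    (hK : ∀ i ∈ K, xs i = 0) {β : ℝ} (hβ : 0 < β) :
    (posterior A y κ β).map
        (fun x => ((fun i : K => β * x i), fun i : J => √β * (x i - xs i))) =
      normalizedDensity volume (fun z => Real.exp (-(κ * rescaledGap A y xs K J β z))) := by
  have hs : √β ≠ 0 := (Real.sqrt_pos.2 hβ).ne'
  let L := blockScaling hd hu hβ.ne' hs
  let e : (Fin p → ℝ) ≃ᵐ (K → ℝ) × (J → ℝ) :=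
    (MeasurableEquiv.subRight xs).trans L.toHomeomorph.toMeasurableEquiv
  have he : (fun x : Fin p → ℝ => ((fun i : K => β * x i), fun i : J => √β * (x i - xs i))) = e := by
    ext x i
    · change _ = β * (x i - xs i)
      rw [hK i i.2, sub_zero]
    · rfl
  have hsymm : ∀ x, xs + glue K J β⁻¹ (√β)⁻¹ (e x) = x := by
    intro x
    have : glue K J β⁻¹ (√β)⁻¹ (e x) = x - xs := by
      rw [← blockScaling_symm_apply hd hu hβ.ne' hs]
      exact L.symm_apply_apply (x - xs)
    rw [this]; abel
  have : (volume : Measure ((K → ℝ) × (J → ℝ))).IsAddHaarMeasure :=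
    Measure.prod.instIsAddHaarMeasure volume volume
  obtain ⟨c, hc0, hct, hc⟩ := exists_map_volume_eq_smul L xs
  have hmap : (volume : Measure (Fin p → ℝ)).map e = c • volume := hc
  rw [he, ← normalizedDensity_smul_measure hc0 hct, ← hmap, ← map_normalizedDensity, posterior,
    measureOfPropDensity_eq]
  congr 1
  -- This factor recenters the exponent at the minimum value of `F`.
  rw [← normalizedDensity_const_mul (Real.exp_pos (κ * β * objective A y xs))]
  congr 1
  ext x
  rw [Function.comp_apply, rescaledGap, hsymm, ← Real.exp_add]
  congr 1
  ring

end ChangeOfVariables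

/-! ### Domination and passage to the limit. -/

section Limit

variable {n p : ℕ} {A : Matrix (Fin n) (Fin p) ℝ} {y : Fin n → ℝ} {xs : Fin p → ℝ} {κ : ℝ}

/-- An integrable function dominating the rescaled posterior densities. -/
theorem exists_integrable_bound (hκ : 0 < κ) (hxs : IsLasso A y xs)
    (hinv : IsUnit ((cols A (bdryI A y xs))ᵀ * cols A (bdryI A y xs))) :
    ∃ c C : ℝ, 0 < c ∧ ∀ β, 1 ≤ β →
      ∀ z : (↥(I0 xs \ bdryI0 A y xs) → ℝ) × (↥(supp xs ∪ bdryI0 A y xs) → ℝ),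
      Real.exp (-(κ * rescaledGap A y xs (I0 xs \ bdryI0 A y xs) (supp xs ∪ bdryI0 A y xs) β z)) ≤
        Real.exp C * (Real.exp (-(c * ∑ i, |z.1 i|)) * Real.exp (-(c * ∑ i, |z.2 i|))) := by
  rw [hxs.bdryI_eq] at hinv
  obtain ⟨c, C, hc, h⟩ := exists_le_rescaledGap (K := I0 xs \ bdryI0 A y xs) hxs disjoint_blocks
    union_blocks (fun i hi => (Finset.mem_filter.1 (Finset.mem_sdiff.1 hi).1).2)
    (fun i hi h1 => (Finset.mem_sdiff.1 hi).2 (Finset.mem_filter.2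
      ⟨Finset.mem_univ _, (Finset.mem_filter.1 (Finset.mem_sdiff.1 hi).1).2, h1⟩)) hinv
  refine ⟨κ * c, κ * C, mul_pos hκ hc, fun β hβ z => ?_⟩
  rw [← Real.exp_add, ← Real.exp_add]
  refine Real.exp_le_exp.2 ?_
  have := mul_le_mul_of_nonneg_left (h β hβ z) hκ.le
  linarith

/-- The uniform bound passes to the pointwise limit. Setting one variable to `0`, where its density
is `1`, then gives integrability of the other density. -/
theorem exists_mul_density_le (hκ : 0 < κ) (hxs : IsLasso A y xs)
    (hinv : IsUnit ((cols A (bdryI A y xs))ᵀ * cols A (bdryI A y xs))) :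
    ∃ c C : ℝ, 0 < c ∧ ∀ u v, laplaceDensity A y xs κ u * gaussDensity A y xs κ v ≤
      Real.exp C * (Real.exp (-(c * ∑ i, |u i|)) * Real.exp (-(c * ∑ i, |v i|))) := by
  obtain ⟨c, C, hc, h⟩ := exists_integrable_bound hκ hxs hinv
  refine ⟨c, C, hc, fun u v => le_of_tendsto (tendsto_exp_rescaledGap hxs hκ (u, v)) ?_⟩
  filter_upwards [eventually_ge_atTop 1] with β hβ using h β hβ (u, v)

theorem integrable_laplaceDensity (hκ : 0 < κ) (hxs : IsLasso A y xs)
    (hinv : IsUnit ((cols A (bdryI A y xs))ᵀ * cols A (bdryI A y xs))) :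
    Integrable (laplaceDensity A y xs κ) := by
  obtain ⟨c, C, hc, h⟩ := exists_mul_density_le hκ hxs hinv
  refine ((integrable_exp_neg_mul_sum_abs hc).const_mul (Real.exp C)).mono'
    continuous_laplaceDensity.aestronglyMeasurable (Eventually.of_forall fun u => ?_)
  rw [Real.norm_of_nonneg (laplaceDensity_pos u).le]
  simpa [gaussDensity_zero] using h u 0

theorem integrable_gaussDensity (hκ : 0 < κ) (hxs : IsLasso A y xs)
    (hinv : IsUnit ((cols A (bdryI A y xs))ᵀ * cols A (bdryI A y xs))) :
    Integrable (gaussDensity A y xs κ) := by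
  obtain ⟨c, C, hc, h⟩ := exists_mul_density_le hκ hxs hinv
  refine ((integrable_exp_neg_mul_sum_abs hc).const_mul (Real.exp C)).mono'
    measurable_gaussDensity.aestronglyMeasurable (Eventually.of_forall fun v => ?_)
  rw [Real.norm_of_nonneg (gaussDensity_nonneg v)]
  simpa [laplaceDensity_zero] using h 0 v

/-- The rescaled posterior converges in total variation to the product of the limit laws. -/
theorem tvClose_rescaled_posterior (hκ : 0 < κ) (hxs : IsLasso A y xs)
    (hinv : IsUnit ((cols A (bdryI A y xs))ᵀ * cols A (bdryI A y xs))) :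
    TVClose
      (fun β => normalizedDensity volume (fun z => Real.exp (-(κ * rescaledGap A y xs
        (I0 xs \ bdryI0 A y xs) (supp xs ∪ bdryI0 A y xs) β z))))
      (fun _ => (measureOfPropDensity (laplaceDensity A y xs κ)).prod
        (measureOfPropDensity (gaussDensity A y xs κ))) := by
  have hli := integrable_laplaceDensity hκ hxs hinv
  have hgi := integrable_gaussDensity hκ hxs hinv
  rw [measureOfPropDensity_eq, measureOfPropDensity_eq,
    normalizedDensity_prod continuous_laplaceDensity.measurable measurable_gaussDensity
      (fun u => (laplaceDensity_pos u).le) hli (integral_laplaceDensity_pos hli)]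
  obtain ⟨c, C, hc, h⟩ := exists_integrable_bound hκ hxs hinv
  refine tvClose_normalizedDensity (μ := volume.prod volume) (fun β => ?_)
    (fun β z => (Real.exp_pos _).le)
    (((integrable_exp_neg_mul_sum_abs hc).mul_prod
      (integrable_exp_neg_mul_sum_abs hc)).const_mul (Real.exp C))
    ((eventually_ge_atTop 1).mono h) (tendsto_exp_rescaledGap hxs hκ) ?_ ?_
  · have := continuous_rescaledGap A y xs (I0 xs \ bdryI0 A y xs) (supp xs ∪ bdryI0 A y xs) β
    exact Continuous.measurable (by fun_prop)
  · exact (continuous_laplaceDensity.measurable.comp measurable_fst).mul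
      (measurable_gaussDensity.comp measurable_snd)
  · rw [integral_prod_mul]
    exact mul_pos (integral_laplaceDensity_pos hli) (integral_gaussDensity_pos hgi)

end Limit

end BayesLasso

end

theorem mainTheorem4 {n p : ℕ} (A : Matrix (Fin n) (Fin p) ℝ) (y : Fin n → ℝ)
    (κ : ℝ) (hκ : 0 < κ)
    (xs : Fin p → ℝ) (hxs : BayesLasso.IsLasso A y xs)
    (hinv : IsUnit ((BayesLasso.cols A (BayesLasso.bdryI A y xs))ᵀ *
      BayesLasso.cols A (BayesLasso.bdryI A y xs)))
    {Ω : ℝ → Type*} [∀ β, MeasurableSpace (Ω β)] (P : ∀ β, Measure (Ω β))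
    [∀ β, IsProbabilityMeasure (P β)] (X : ∀ β, Ω β → Fin p → ℝ)
    (hX : ∀ β, 0 < β → HasLaw (X β) (BayesLasso.posterior A y κ β) (P β)) :
    BayesLasso.AsympIndep P
      (fun β ω (i : ↥(BayesLasso.I0 xs \ BayesLasso.bdryI0 A y xs)) => β * X β ω i)
      (fun β ω (i : ↥(BayesLasso.supp xs ∪ BayesLasso.bdryI0 A y xs)) =>
        √β * (X β ω i - xs i)) ∧
    BayesLasso.HasAsympDensity P
      (fun β ω (i : ↥(BayesLasso.I0 xs \ BayesLasso.bdryI0 A y xs)) => β * X β ω i)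
      (BayesLasso.laplaceDensity A y xs κ) ∧
    BayesLasso.HasAsympDensity P
      (fun β ω (i : ↥(BayesLasso.supp xs ∪ BayesLasso.bdryI0 A y xs)) =>
        √β * (X β ω i - xs i))
      (BayesLasso.gaussDensity A y xs κ) := by
  have hli := BayesLasso.integrable_laplaceDensity hκ hxs hinv
  have hgi := BayesLasso.integrable_gaussDensity hκ hxs hinv
  have hl : IsProbabilityMeasure
      (BayesLasso.measureOfPropDensity (BayesLasso.laplaceDensity A y xs κ)) :=
    BayesLasso.isProbabilityMeasure_normalizedDensity
      (fun u => (BayesLasso.laplaceDensity_pos u).le) hli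
      (BayesLasso.integral_laplaceDensity_pos hli)
  have hg : IsProbabilityMeasure
      (BayesLasso.measureOfPropDensity (BayesLasso.gaussDensity A y xs κ)) :=
    BayesLasso.isProbabilityMeasure_normalizedDensity BayesLasso.gaussDensity_nonneg hgi
      (BayesLasso.integral_gaussDensity_pos hgi)
  have hXm : ∀ β, 0 < β → AEMeasurable (X β) (P β) := fun β hβ => (hX β hβ).aemeasurable
  -- The law of `X β` is prescribed only for `β > 0`, so the identification of the joint law is an
  -- eventual one.
  have hjoint := (BayesLasso.tvClose_rescaled_posterior hκ hxs hinv).congr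
    (μ' := fun β => (P β).map fun ω =>
      ((fun i : ↥(BayesLasso.I0 xs \ BayesLasso.bdryI0 A y xs) => β * X β ω i),
        fun i : ↥(BayesLasso.supp xs ∪ BayesLasso.bdryI0 A y xs) => √β * (X β ω i - xs i))) <| by
    filter_upwards [eventually_gt_atTop 0] with β hβ
    rw [← BayesLasso.map_posterior BayesLasso.disjoint_blocks BayesLasso.union_blocks A y κ xs
      (fun i hi => (Finset.mem_filter.1 (Finset.mem_sdiff.1 hi).1).2) hβ, ← (hX β hβ).map_eq,
      AEMeasurable.map_map_of_aemeasurable (Continuous.aemeasurable (by fun_prop)) (hXm β hβ)]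
    rfl
  obtain ⟨h1, h2, h3⟩ := BayesLasso.asympIndep_of_tvClose_prod
    (U := fun β ω (i : ↥(BayesLasso.I0 xs \ BayesLasso.bdryI0 A y xs)) => β * X β ω i)
    (V := fun β ω (i : ↥(BayesLasso.supp xs ∪ BayesLasso.bdryI0 A y xs)) =>
      √β * (X β ω i - xs i))
    (by
      filter_upwards [eventually_gt_atTop 0] with β hβ
      exact (Continuous.measurable (f := fun (x : Fin p → ℝ)
        (i : ↥(BayesLasso.I0 xs \ BayesLasso.bdryI0 A y xs)) => β * x i)
        (by fun_prop)).comp_aemeasurable (hXm β hβ))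
    (by
      filter_upwards [eventually_gt_atTop 0] with β hβ
      exact (Continuous.measurable (f := fun (x : Fin p → ℝ)
        (i : ↥(BayesLasso.supp xs ∪ BayesLasso.bdryI0 A y xs)) => √β * (x i - xs i))
        (by fun_prop)).comp_aemeasurable (hXm β hβ)) hjoint
  exact ⟨h1, ⟨hl, h2⟩, ⟨hg, h3⟩⟩
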